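/- Fix $k\in\mathbb N$ and a finite alphabet $\Sigma$. A $k$-VASS $V$ over $\Sigma$ consists of a finite set of states $Q$, an initial configuration $c_0\in Q\times\mathbb N^k$, a finite set $F\subseteq Q\times\mathbb N^k$ of final configurations and a finite transition relation $\delta\subseteq Q\times\Sigma\times\mathbb Z^k\times Q$. A transition $(s,a,v,s')$ is over the letter $a$; it can be fired in a configuration $(s,u)\in Q\times\mathbb N^k$ if $u+v\ge 0$, and leads to $(s',u+v)$. A run is a sequence of transitions that can be fired one after another. A configuration $(q,u)$ is accepting if $u\ge u'$ for some $(q,u')\in F$. The language $L(V)$ is the set of words read by runs from $c_0$ to an accepting configuration, and the trace language $L_T(V)$ is the set of words read by arbitrary runs from $c_0$ (so $L_T(V)=L(V)$ if $F=Q\times\{0\}$). $V$ is deterministic if for each state $q$ and each letter $a$ at most one transition over $a$ leaves $q$. A resolver is a partial function that, given a history of a run (the configurations and the transitions taken), a current configuration $c$ and a letter $a$, returns a transition over $a$ that can be fired in $c$, whenever there is one. $V$ is history-deterministic if there is a resolver $r$ such that for each $w\in L(V)$ the run over $w$ from $c_0$ given by $r$ exists and is accepting. $V_0$ simulates $V_1$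 if Duplicator has a winning strategy in the following game, in which Spoiler starts in the initial configuration of $V_1$ and Duplicator in that of $V_0$. In each round Spoiler fires a transition of $V_1$ in his configuration (he loses if there is none), over some letter $a$, and then Duplicator fires a transition of $V_0$ over the same letter $a$ in his configuration (he loses if there is none). Duplicator wins infinite plays. $A$ and $B$ are in two-sided simulation if each of them simulates the other. **Theorem.** Let $\Sigma$ be a finite alphabet with at least two letters, and let $R$ be any equivalence relation on the set of all $2$-VASSs over $\Sigma$ such that $(A,B)\in R$ whenever $A$ and $B$ are in two-sided simulation, and $(A,B)\notin R$ whenever $L_T(A)\ne L_T(B)$. Then it is undecidable whether $(A,B)\in R$, for a given deterministic $2$-VASS $A$ and a given history-deterministic $2$-VASS $B$: there is no algorithm that answers this correctly for all such pairs (whatever it does on other inputs). This remains true if only VASSs $A$, $B$ in which all configurations are accepting, $F=Q\times\{0\}$, are given. -/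

import Mathlib

/-- A transition `(s, a, v, s')` of a `k`-dimensional VASS with state set `Q` and alphabet `α`. -/
structure VASSTransition (Q α : Type*) (k : ℕ) where
  /-- source state -/
  src : Q
  /-- letter read by the transition -/
  letter : α
  /-- effect on the counters -/
  eff : Fin k → ℤ
  /-- target state -/
  tgt : Q

/-- A `k`-dimensional vector addition system with states over the alphabet `α`. The finite state
set is `{0, …, numStates - 1}`. -/
structure VASS (α : Type*) (k : ℕ) where
  /-- number of states -/
  numStates : ℕ
  /-- initial configuration -/
  init : Fin numStates × (Fin k → ℕ)
  /-- finite set of final configurations -/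
  final : Finset (Fin numStates × (Fin k → ℕ))
  /-- finite transition relation -/
  trans : Finset (VASSTransition (Fin numStates) α k)

namespace VASS

/-- Configurations `q(u)`: a state together with the (non-negative) values of the counters. -/
abbrev Config {α : Type*} {k : ℕ} (V : VASS α k) : Type :=
  Fin V.numStates × (Fin k → ℕ)

/-- The type of tuples `(s, a, v, s')`; the actual transitions of `V` are those in `V.trans`. -/
abbrev Trans {α : Type*} {k : ℕ} (V : VASS α k) : Type _ :=
  VASSTransition (Fin V.numStates) α k

/-- `t` is a transition of `V` that can be fired in `c`, and firing it leads to `c'`. As counter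
values are natural numbers, such a `c'` exists only if no counter becomes negative. -/
def Step {α : Type*} {k : ℕ} (V : VASS α k) (c : V.Config) (t : V.Trans) (c' : V.Config) : Prop :=
  t ∈ V.trans ∧ c.1 = t.src ∧ c'.1 = t.tgt ∧ ∀ i, (c'.2 i : ℤ) = (c.2 i : ℤ) + t.eff i

/-- `t` is a transition of `V` over the letter `a` that can be fired in `c`. -/
def EnabledOver {α : Type*} {k : ℕ} (V : VASS α k) (c : V.Config) (a : α) (t : V.Trans) : Prop :=
  t.letter = a ∧ ∃ c', V.Step c t c'

/-- The sequence of transitions `ρ` is a run from `c` to `c'`. -/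
def IsRun {α : Type*} {k : ℕ} (V : VASS α k) : V.Config → List V.Trans → V.Config → Prop
  | c, [], c' => c = c'
  | c, t :: ρ, c' => ∃ d, V.Step c t d ∧ V.IsRun d ρ c'

/-- A configuration is accepting if it covers some final configuration. -/
def Accepting {α : Type*} {k : ℕ} (V : VASS α k) (c : V.Config) : Prop :=
  ∃ f ∈ V.final, f.1 = c.1 ∧ f.2 ≤ c.2

/-- The coverability language `L(V)`. -/
def language {α : Type*} {k : ℕ} (V : VASS α k) : Language α :=
  {w | ∃ ρ c, V.IsRun V.init ρ c ∧ ρ.map VASSTransition.letter = w ∧ V.Accepting c}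

/-- The trace language `L_T(V)`: the words read by the runs from the initial configuration. -/
def traceLanguage {α : Type*} {k : ℕ} (V : VASS α k) : Language α :=
  {w | ∃ ρ c, V.IsRun V.init ρ c ∧ ρ.map VASSTransition.letter = w}

/-- The set of final configurations is `Q × {0}`, so that all configurations are accepting. -/
def AllAccepting {α : Type*} {k : ℕ} (V : VASS α k) : Prop :=
  ∀ c : V.Config, c ∈ V.final ↔ c.2 = 0

/-- At most one transition leaves each state over each letter. -/
def IsDeterministic {α : Type*} {k : ℕ} (V : VASS α k) : Prop :=
  ∀ t ∈ V.trans, ∀ t' ∈ V.trans, t.src = t'.src → t.letter = t'.letter → t = t'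

/-- A resolver takes a history (configurations and the transitions taken in them), the current
configuration `c` and the next letter `a`, and returns a transition over `a` that can be fired in
`c`. It is undefined (`none`) if there is no such transition. -/
def IsResolver {α : Type*} {k : ℕ} (V : VASS α k)
    (r : List (V.Config × V.Trans) → V.Config → α → Option V.Trans) : Prop :=
  ∀ h c a, (∀ t, r h c a = some t → V.EnabledOver c a t) ∧
    ((∃ t, V.EnabledOver c a t) → ∃ t, r h c a = some t)

/-- `V.ResolverRun r h c w c'`: with history `h`, the run over `w` from `c` whose transitions are
given by `r` exists and ends in `c'`. -/
def ResolverRun {α : Type*} {k : ℕ} (V : VASS α k)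
    (r : List (V.Config × V.Trans) → V.Config → α → Option V.Trans) :
    List (V.Config × V.Trans) → V.Config → List α → V.Config → Prop
  | _, c, [], c' => c = c'
  | h, c, a :: w, c' =>
      ∃ t d, r h c a = some t ∧ V.Step c t d ∧ V.ResolverRun r (h ++ [(c, t)]) d w c'

/-- `V` is history-deterministic: some resolver yields an accepting run over each word of `L(V)`. -/
def IsHistoryDeterministic {α : Type*} {k : ℕ} (V : VASS α k) : Prop :=
  ∃ r, V.IsResolver r ∧ ∀ w ∈ V.language, ∃ c, V.ResolverRun r [] V.init w c ∧ V.Accepting c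

/-- A strategy of Duplicator (who plays in `V₀`) against Spoiler (who plays in `V₁`): it maps the
rounds played so far and the new transition chosen by Spoiler to the answer of Duplicator. -/
abbrev DuplicatorStrategy {α : Type*} {k : ℕ} (V₀ V₁ : VASS α k) : Type _ :=
  List (V₁.Trans × V₀.Trans) → V₁.Trans → V₀.Trans

/-- `PlayReaches V₀ V₁ σ h s d`: the sequence of rounds `h` can be played in the simulation game
with Duplicator following `σ`, and then Spoiler is in `s` and Duplicator in `d`. -/
inductive PlayReaches {α : Type*} {k : ℕ} (V₀ V₁ : VASS α k) (σ : DuplicatorStrategy V₀ V₁) :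
    List (V₁.Trans × V₀.Trans) → V₁.Config → V₀.Config → Prop
  | start : PlayReaches V₀ V₁ σ [] V₁.init V₀.init
  | round {h : List (V₁.Trans × V₀.Trans)} {s s' : V₁.Config} {d d' : V₀.Config} {t : V₁.Trans} :
      PlayReaches V₀ V₁ σ h s d → V₁.Step s t s' → (σ h t).letter = t.letter →
      V₀.Step d (σ h t) d' → PlayReaches V₀ V₁ σ (h ++ [(t, σ h t)]) s' d'

/-- `V₀` simulates `V₁`: Duplicator has a strategy in the simulation game with which he can always
answer the transition chosen by Spoiler (so either Spoiler gets stuck or the play is infinite). -/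
def Simulates {α : Type*} {k : ℕ} (V₀ V₁ : VASS α k) : Prop :=
  ∃ σ : DuplicatorStrategy V₀ V₁, ∀ h s d, PlayReaches V₀ V₁ σ h s d →
    ∀ t s', V₁.Step s t s' → V₀.EnabledOver d t.letter (σ h t)

/-- Two-sided simulation. -/
def TwoSidedSimulation {α : Type*} {k : ℕ} (A B : VASS α k) : Prop :=
  A.Simulates B ∧ B.Simulates A

/-- Finite descriptions of VASSs, the inputs of algorithms: the number of states, the initial
configuration, a list of the final configurations and a list of the transitions. -/
abbrev Description (α : Type*) (k : ℕ) : Type _ :=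
  ℕ × (ℕ × (Fin k → ℕ)) × List (ℕ × (Fin k → ℕ)) × List (ℕ × α × (Fin k → ℤ) × ℕ)

/-- `D` describes `V`; the lists may be in any order and may have repetitions. -/
def DescribedBy {α : Type*} {k : ℕ} (V : VASS α k) (D : Description α k) : Prop :=
  D.1 = V.numStates ∧
  D.2.1 = (V.init.1.val, V.init.2) ∧
  (∀ x, x ∈ D.2.2.1 ↔ ∃ c ∈ V.final, x = (c.1.val, c.2)) ∧
  (∀ x, x ∈ D.2.2.2 ↔ ∃ t ∈ V.trans, x = (t.src.val, t.letter, t.eff, t.tgt.val))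

/-- There is an algorithm which, given descriptions of two VASSs `A` and `B` with `P A B`, halts
and answers whether `R A B` holds. Nothing is required of it on other inputs. -/
def DecidableOn {α : Type*} [Primcodable α] {k : ℕ} (P R : VASS α k → VASS α k → Prop) : Prop :=
  ∃ f : Description α k × Description α k →. Bool, Partrec f ∧
    ∀ (A B : VASS α k) (D E : Description α k), A.DescribedBy D → B.DescribedBy E → P A B →
      ∃ b ∈ f (D, E), (b = true ↔ R A B)

end VASS

/-! The proof diagonalises over a two-counter machine whose only instruction is: try to add a
vector, and branch on whether a counter would become negative. Such a machine `M` with halting state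
`h` yields two VASSs. In the deterministic one, `honestVASS`, the letter `b` performs the addition,
so it can only be read if the addition succeeds, while `a` claims failure and can always be read.
The other one, `detectVASS`, follows the same run but has no transition in `h`. If `a` is a lie, it
can prove this by firing the addition. It then remembers the effect as a debt, repays it within the
next transition, and from then on does whatever `honestVASS` does, no longer stopping in `h`.

`honestVASS` always simulates `detectVASS`, since counters plus debt evolve deterministically
(`exists_honest_of_detect`). If `M` never reaches `h`, the converse holds: Spoiler either stays on
the true run, which avoids `h`, or lies and is detected. If `M` reaches `h`, the truthful word
followed by `a` separates the trace languages, because without a lie nothing can be detected.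
`detectVASS` is history-deterministic in both cases: the resolver detects whenever possible, which
loses no continuation, and otherwise there is no choice. So any admissible `R` decides whether `M`
halts.

Let `M` evaluate the `n`-th partial recursive function at `n` and reach `h` if the value is
positive, but not if it is `0`. A decision procedure for `R`, read as a function with values `1` and
`0`, then contradicts itself at its own index. Only inputs with a defined value matter, so
simulations of terminating computations suffice: programs with loops, then multiplication and
division on a Gödel number, then two counters. -/

open Function (update)

/-! ### Partial recursive functions as loop programs -/

/-- Programs over registers that hold natural numbers. `loop r P` means: while register `r` is
positive, decrement it and run `P`. -/
inductive LoopProg : Type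
  | skip : LoopProg
  | inc : ℕ → LoopProg
  | seq : LoopProg → LoopProg → LoopProg
  | loop : ℕ → LoopProg → LoopProg

namespace LoopProg

/-- `Exec P s s'`: the program `P`, started with register contents `s`, terminates with `s'`. -/
inductive Exec : LoopProg → (ℕ → ℕ) → (ℕ → ℕ) → Prop
  | skip (s : ℕ → ℕ) : Exec skip s s
  | inc (r : ℕ) (s : ℕ → ℕ) : Exec (inc r) s (update s r (s r + 1))
  | seq {P Q : LoopProg} {s s' s'' : ℕ → ℕ} : Exec P s s' → Exec Q s' s'' → Exec (seq P Q) s s''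
  | loop_zero {r : ℕ} {P : LoopProg} {s : ℕ → ℕ} : s r = 0 → Exec (loop r P) s s
  | loop_succ {r : ℕ} {P : LoopProg} {s s' s'' : ℕ → ℕ} {n : ℕ} : s r = n + 1 →
      Exec P (update s r n) s' → Exec (loop r P) s' s'' → Exec (loop r P) s s''

theorem Exec.of_eq {P : LoopProg} {s s' t : ℕ → ℕ} (h : Exec P s t) (e : t = s') : Exec P s s' :=
  e ▸ h

/-- A loop whose register counts down is executed along a sequence of states. -/
theorem exec_loop_of_countdown {r : ℕ} {P : LoopProg} (S : ℕ → ℕ → ℕ) (K : ℕ)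
    (hr : ∀ k ≤ K, S k r = k) (hP : ∀ k < K, Exec P (update (S (k + 1)) r k) (S k)) :
    Exec (loop r P) (S K) (S 0) := by
  induction K with
  | zero => exact .loop_zero (hr 0 le_rfl)
  | succ K ih =>
    exact .loop_succ (hr (K + 1) le_rfl) (hP K (by omega))
      (ih (fun k hk => hr k (by omega)) fun k hk => hP k (by omega))

/-- Set register `r` to zero. -/
def clear (r : ℕ) : LoopProg := loop r skip

theorem exec_clear (r : ℕ) (s : ℕ → ℕ) : Exec (clear r) s (update s r 0) := by
  have h := exec_loop_of_countdown (r := r) (P := skip) (fun k => update s r k) (s r)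
    (by simp) (fun k _ => by simpa using Exec.skip _)
  simpa [clear] using h

/-- Add register `x` to register `y`, and clear `x`. -/
def move (x y : ℕ) : LoopProg := loop x (inc y)

theorem exec_move {x y : ℕ} (hxy : x ≠ y) (s : ℕ → ℕ) :
    Exec (move x y) s (update (update s y (s y + s x)) x 0) := by
  have h := exec_loop_of_countdown (r := x) (P := inc y)
    (fun k => update (update s y (s y + (s x - k))) x k) (s x) (by simp) (fun k hk => by
      refine (Exec.inc y _).of_eq ?_
      funext i
      by_cases h1 : i = x <;> by_cases h2 : i = y <;> simp_all [Function.update_apply]; omega)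
  simpa [move] using h

/-- Copy register `x` to register `y`, with scratch register `t`. -/
def copy (x y t : ℕ) : LoopProg :=
  if x = y then skip else seq (clear y) (seq (loop x (seq (inc y) (inc t))) (move t x))

theorem exec_copy {x y t : ℕ} (hx : t ≠ x) (hy : t ≠ y) {s : ℕ → ℕ} (ht : s t = 0) :
    Exec (copy x y t) s (update s y (s x)) := by
  unfold copy
  split_ifs with hxy
  · subst hxy
    simpa using Exec.skip s
  · refine .seq (exec_clear y s) ?_
    have h := exec_loop_of_countdown (r := x) (P := seq (inc y) (inc t))
      (fun k => update (update (update s y (s x - k)) t (s x - k)) x k) (s x) (by simp)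
      (fun k hk => by
        refine (Exec.seq (Exec.inc y _) (Exec.inc t _)).of_eq ?_
        funext i
        by_cases h1 : i = x <;> by_cases h2 : i = y <;> by_cases h3 : i = t <;>
          simp_all [Function.update_apply] <;> omega)
    have e : update (update (update s y (s x - s x)) t (s x - s x)) x (s x) = update s y 0 := by
      funext i
      by_cases h1 : i = x <;> by_cases h2 : i = y <;> by_cases h3 : i = t <;>
          simp_all
    rw [e] at h
    refine .seq h ((exec_move hx _).of_eq ?_)
    funext i
    by_cases h1 : i = x <;> by_cases h2 : i = y <;> by_cases h3 : i = t <;>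
      simp_all

/-- Clear the registers `m, …, m + j - 1`. -/
def clearRange (m : ℕ) : ℕ → LoopProg
  | 0 => skip
  | j + 1 => seq (clearRange m j) (clear (m + j))

theorem exec_clearRange (m j : ℕ) (s : ℕ → ℕ) :
    Exec (clearRange m j) s (fun r => if m ≤ r ∧ r < m + j then 0 else s r) := by
  induction j with
  | zero =>
    refine (Exec.skip s).of_eq ?_
    funext r
    rw [if_neg (by omega)]
  | succ j ih =>
    refine .seq ih ((exec_clear _ _).of_eq ?_)
    funext r
    rw [Function.update_apply]
    split_ifs <;> first | rfl | omega

/-- The relation `F` (the graph of a partial function) is computed by programs, for any choice of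
input registers, of the output register, and of a bound from which on registers are free. -/
def Computes {n : ℕ} (F : List.Vector ℕ n → ℕ → Prop) : Prop :=
  ∀ (x : Fin n → ℕ) (o m : ℕ), (∀ i, x i < m) → o < m → ∃ P, ∀ (s : ℕ → ℕ) (v : List.Vector ℕ n) (y : ℕ),
    (∀ r, m ≤ r → s r = 0) → (∀ i, s (x i) = v.get i) → F v y → Exec P s (update s o y)

theorem computes_zero : Computes (n := 0) (fun _ y => y = 0) := fun _ o _ _ _ =>
  ⟨clear o, fun s _ _ _ _ hy => hy ▸ exec_clear o s⟩

theorem computes_get {n : ℕ} (i : Fin n) : Computes (fun v y => y = v.get i) := fun x o m hx ho =>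
  ⟨copy (x i) o m, fun s v y hs hv hy => by
    rw [hy, ← hv]
    exact exec_copy (hx i).ne' ho.ne' (hs m le_rfl)⟩

theorem computes_succ : Computes (n := 1) (fun v y => y = v.head + 1) := fun x o m hx ho =>
  ⟨seq (copy (x 0) o m) (inc o), fun s v y hs hv hy => by
    refine .seq (exec_copy (hx 0).ne' ho.ne' (hs m le_rfl)) ((Exec.inc _ _).of_eq ?_)
    simp [hy, hv]⟩

/-- The arguments go to the fresh registers `m, …, m + k - 1`, with scratch space only from `m + k`
on. Clearing these registers at the end restores the invariant that free registers are zero. The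
witness `w` makes this usable for partial functions. -/
theorem Computes.comp {n k : ℕ} {F : List.Vector ℕ k → ℕ → Prop}
    {G : Fin k → List.Vector ℕ n → ℕ → Prop} (hF : Computes F) (hG : ∀ i, Computes (G i)) :
    Computes (fun v y => ∃ w : List.Vector ℕ k, (∀ i, G i v (w.get i)) ∧ F w y) := by
  intro x o m hx ho
  have args : ∀ j ≤ k, ∃ P, ∀ (s : ℕ → ℕ) (v : List.Vector ℕ n) (w : List.Vector ℕ k),
      (∀ r, m ≤ r → s r = 0) → (∀ i, s (x i) = v.get i) → (∀ i, G i v (w.get i)) →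
      Exec P s (fun r => if h : m ≤ r ∧ r < m + j ∧ r < m + k then w.get ⟨r - m, by omega⟩
        else s r) := by
    -- The conjunct `r < m + k` in the claim makes the index valid without using `j ≤ k`.
    intro j
    induction j with
    | zero =>
      refine fun _ => ⟨skip, fun s v w _ _ _ => (Exec.skip s).of_eq ?_⟩
      funext r
      rw [dif_neg (by omega)]
    | succ j ih =>
      intro hj
      obtain ⟨P, hP⟩ := ih (by omega)
      obtain ⟨Q, hQ⟩ := hG ⟨j, hj⟩ x (m + j) (m + k) (fun i => (hx i).trans_le (by omega)) (by omega)
      refine ⟨seq P Q, fun s v w hs hv hw => .seq (hP s v w hs hv hw) ((hQ _ v _ ?_ ?_ (hw _)).of_eq ?_)⟩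
      · intro r hr
        rw [dif_neg (by omega)]
        exact hs r (by omega)
      · intro i
        have := hx i
        rw [dif_neg (by omega), hv]
      · funext r
        rw [Function.update_apply]
        by_cases h1 : r = m + j
        · subst h1
          rw [if_pos rfl, dif_pos (by omega)]
          congr 2
          omega
        · rw [if_neg h1]
          by_cases h2 : m ≤ r ∧ r < m + j
          · rw [dif_pos (by omega), dif_pos (by omega)]
          · rw [dif_neg (by omega), dif_neg (by omega)]
  obtain ⟨P, hP⟩ := args k le_rfl
  obtain ⟨Q, hQ⟩ := hF (fun i => m + i) o (m + k) (by simp) (by omega)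
  refine ⟨seq P (seq Q (clearRange m k)), fun s v y hs hv hy => ?_⟩
  obtain ⟨w, hw, hy⟩ := hy
  refine .seq (hP s v w hs hv hw) (.seq (hQ _ w y ?_ ?_ hy) ((exec_clearRange _ _ _).of_eq ?_))
  · intro r hr
    rw [dif_neg (by omega)]
    exact hs r (by omega)
  · intro i
    have := i.2
    rw [dif_pos (by omega)]
    congr 1
    ext
    simp
  · funext r
    by_cases h1 : m ≤ r ∧ r < m + k
    · rw [if_pos h1, Function.update_of_ne (by omega), hs r h1.1]
    · rw [if_neg h1]
      simp only [Function.update_apply]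
      rw [dif_neg (by omega)]

/-- Register `m` counts the remaining rounds, `m + 1` holds the index of the recursion and `m + 2`
the current value. The program for `g` overwrites its own input `m + 2`, which `Computes` permits.
-/
theorem Computes.prec {n : ℕ} {f : List.Vector ℕ n → ℕ} {g : List.Vector ℕ (n + 2) → ℕ}
    (hf : Computes (fun v y => y = f v)) (hg : Computes (fun v y => y = g v)) :
    Computes (fun (v : List.Vector ℕ (n + 1)) y =>
      y = v.head.rec (f v.tail) fun k IH => g (k ::ᵥ IH ::ᵥ v.tail)) := by
  intro x o m hx ho
  obtain ⟨P, hP⟩ := hf (fun i => x i.succ) (m + 2) (m + 3)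
    (fun i => (hx _).trans_le (by omega)) (by omega)
  obtain ⟨Q, hQ⟩ := hg (Fin.cons (m + 1) (Fin.cons (m + 2) fun i => x i.succ)) (m + 2) (m + 3)
    (by
      refine Fin.cases (by simp) (Fin.cases (by simp) fun i => ?_)
      simpa using (hx i.succ).trans_le (by omega)) (by omega)
  refine ⟨seq (copy (x 0) m (m + 3)) (seq P (seq (loop m (seq Q (inc (m + 1))))
    (seq (copy (m + 2) o (m + 3)) (clearRange m 3)))), fun s v y hs hv hy => ?_⟩
  have hx0 := hx 0
  have hv0 : s (x 0) = v.head := by rw [hv, List.Vector.get_zero]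
  have hvt : ∀ i : Fin n, s (x i.succ) = v.tail.get i := fun i => by
    rw [hv, List.Vector.get_tail_succ]
  -- `R j` is the value after `j` rounds; `T c k a` is the register content with the counter, index
  -- and value given.
  let R : ℕ → ℕ := fun j => j.rec (f v.tail) fun k IH => g (k ::ᵥ IH ::ᵥ v.tail)
  let T : ℕ → ℕ → ℕ → ℕ → ℕ := fun c k a => update (update (update s m c) (m + 1) k) (m + 2) a
  have hT : ∀ c k a r, r < m → T c k a r = s r := fun c k a r hr => by
    simp only [T]
    rw [Function.update_of_ne (by omega), Function.update_of_ne (by omega),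
      Function.update_of_ne (by omega)]
  have hT3 : ∀ c k a r, m + 3 ≤ r → T c k a r = 0 := fun c k a r hr => by
    simp only [T]
    rw [Function.update_of_ne (by omega), Function.update_of_ne (by omega),
      Function.update_of_ne (by omega), hs r (by omega)]
  have h0 : update s m (s (x 0)) = T v.head 0 0 := by
    funext r
    simp only [T, Function.update_apply]
    split_ifs <;> first | rfl | omega | exact hv0 | exact hs r (by omega)
  have h1 : ∀ c k a a', update (T c k a) (m + 2) a' = T c k a' := fun c k a a' => by simp [T]
  have h2 : ∀ c k a k', update (T c k a) (m + 1) k' = T c k' a := fun c k a k' => by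
    funext r
    simp only [T, Function.update_apply]
    split_ifs <;> first | rfl | omega
  have h3 : ∀ c k a c', update (T c k a) m c' = T c' k a := fun c k a c' => by
    funext r
    simp only [T, Function.update_apply]
    split_ifs <;> first | rfl | omega
  have e1 : ∀ c k a, T c k a (m + 1) = k := by simp [T]
  have e2 : ∀ c k a, T c k a (m + 2) = a := by simp [T]
  have e0 : ∀ c k a, T c k a m = c := by simp [T]
  refine .seq (exec_copy (by omega) (by omega) (hs _ (by omega))) ?_
  rw [h0]
  refine .seq (hP _ v.tail (f v.tail) (hT3 _ _ _) (fun i => ?_) rfl) ?_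
  · rw [hT _ _ _ _ (hx _), hvt]
  rw [h1]
  have loop := exec_loop_of_countdown (r := m) (P := seq Q (inc (m + 1)))
    (fun c => T c (v.head - c) (R (v.head - c))) v.head (by simp [e0]) (fun c hc => by
      rw [h3]
      refine .seq (hQ _ ((v.head - (c + 1)) ::ᵥ R (v.head - (c + 1)) ::ᵥ v.tail) _ (hT3 _ _ _) ?_ rfl)
        ((Exec.inc _ _).of_eq ?_)
      · refine Fin.cases ?_ (Fin.cases ?_ fun i => ?_)
        · simp [e1]
        · rw [Fin.cons_succ, Fin.cons_zero, e2, List.Vector.get_cons_succ,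
            List.Vector.get_cons_zero]
        · simp [hT _ _ _ _ (hx i.succ), hvt]
      · have e : v.head - c = v.head - (c + 1) + 1 := by omega
        rw [h1, h2, e1, e])
  simp only [Nat.sub_self, Nat.sub_zero] at loop
  refine .seq loop (.seq (exec_copy (by omega) (by omega) (hT3 _ _ _ _ le_rfl))
    ((exec_clearRange _ _ _).of_eq ?_))
  rw [e2]
  funext r
  have hy' : y = R v.head := hy
  rw [hy']
  by_cases h1 : m ≤ r ∧ r < m + 3
  · rw [if_pos h1, Function.update_of_ne (by omega), hs r h1.1]
  · rw [if_neg h1, Function.update_apply, Function.update_apply]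
    split_ifs
    · rfl
    · by_cases h2 : r < m
      · exact hT _ _ _ _ h2
      · rw [hT3 _ _ _ _ (by omega), hs r (by omega)]

/-- Register `m` holds the candidate and `m + 1` the value of `f` there. The loop runs while this
value is positive; its decrement is harmless because the body recomputes the value. -/
theorem Computes.rfind {n : ℕ} {f : List.Vector ℕ (n + 1) → ℕ} (hf : Computes (fun v y => y = f v)) :
    Computes (fun (v : List.Vector ℕ n) y => f (y ::ᵥ v) = 0 ∧ ∀ k < y, f (k ::ᵥ v) ≠ 0) := by
  intro x o m hx ho
  obtain ⟨P, hP⟩ := hf (Fin.cons m x) (m + 1) (m + 2)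
    (by
      refine Fin.cases (by simp) fun i => ?_
      simpa using (hx i).trans_le (by omega)) (by omega)
  refine ⟨seq P (seq (loop (m + 1) (seq (inc m) P)) (seq (copy m o (m + 2)) (clear m))),
    fun s v y hs hv hy => ?_⟩
  let T : ℕ → ℕ → ℕ → ℕ := fun k a => update (update s m k) (m + 1) a
  have hT : ∀ k a r, r < m → T k a r = s r := fun k a r hr => by
    simp only [T]
    rw [Function.update_of_ne (by omega), Function.update_of_ne (by omega)]
  have hT2 : ∀ k a r, m + 2 ≤ r → T k a r = 0 := fun k a r hr => by
    simp only [T]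
    rw [Function.update_of_ne (by omega), Function.update_of_ne (by omega), hs r (by omega)]
  have h0 : s = T 0 0 := by
    funext r
    simp only [T, Function.update_apply]
    split_ifs <;> first | rfl | exact hs r (by omega)
  have h1 : ∀ k a a', update (T k a) (m + 1) a' = T k a' := fun k a a' => by simp [T]
  have h2 : ∀ k a k', update (T k a) m k' = T k' a := fun k a k' => by
    funext r
    simp only [T, Function.update_apply]
    split_ifs <;> first | rfl | omega
  have e0 : ∀ k a, T k a m = k := by simp [T]
  have e1 : ∀ k a, T k a (m + 1) = a := by simp [T]
  have body : ∀ k a, Exec P (T k a) (T k (f (k ::ᵥ v))) := fun k a => by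
    refine (hP _ (k ::ᵥ v) _ (hT2 _ _) ?_ rfl).of_eq (h1 _ _ _)
    refine Fin.cases ?_ fun i => ?_
    · simp [e0]
    · simp [hT _ _ _ (hx i), hv]
  -- The loop register does not count down, so the induction is on the distance `j` from the
  -- candidate `k` to the least zero `y`.
  have loop : ∀ j k, k + j = y →
      Exec (loop (m + 1) (seq (inc m) P)) (T k (f (k ::ᵥ v))) (T y 0) := by
    intro j
    induction j with
    | zero =>
      rintro k rfl
      have := hy.1
      simp only [Nat.add_zero] at this
      simp only [Nat.add_zero, this]
      exact .loop_zero (e1 _ _)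
    | succ j ih =>
      intro k hk
      obtain ⟨a, ha⟩ := Nat.exists_eq_succ_of_ne_zero (hy.2 k (by omega))
      refine .loop_succ (by rw [e1, ha]) ?_ (ih (k + 1) (by omega))
      rw [h1]
      refine .seq ((Exec.inc _ _).of_eq ?_) (body _ a)
      rw [h2, e0]
  have start := body 0 0
  rw [← h0] at start
  refine .seq start (.seq (loop y 0 (by omega))
    (.seq (exec_copy (by omega) (by omega) (hT2 _ _ _ le_rfl)) ((exec_clear _ _).of_eq ?_)))
  rw [e0]
  funext r
  simp only [T, Function.update_apply]
  split_ifs <;> first | rfl | omega | exact (hs r (by omega)).symm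

theorem computes_of_primrec {n : ℕ} {f : List.Vector ℕ n → ℕ} (hf : Nat.Primrec' f) :
    Computes (fun v y => y = f v) := by
  induction hf with
  | zero => exact computes_zero
  | succ => exact computes_succ
  | get i => exact computes_get i
  | comp g _ _ ihf ihg =>
    intro x o m hx ho
    obtain ⟨P, hP⟩ := ihf.comp ihg x o m hx ho
    exact ⟨P, fun s v y hs hv hy => hP s v y hs hv ⟨.ofFn fun i => g i v, by simp, hy⟩⟩
  | prec _ _ ihf ihg => exact ihf.prec ihg

theorem get_mem_of_mem_mOfFn {n : ℕ} {g : Fin n → Part ℕ} {w : List.Vector ℕ n}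
    (hw : w ∈ List.Vector.mOfFn g) (i : Fin n) : w.get i ∈ g i := by
  induction n with
  | zero => exact i.elim0
  | succ n ih =>
    simp only [List.Vector.mOfFn, Part.bind_eq_bind, Part.mem_bind_iff, Part.pure_eq_some,
      Part.mem_some_iff] at hw
    obtain ⟨a, ha, w', hw', rfl⟩ := hw
    refine Fin.cases ?_ (fun i => ?_) i
    · simpa using ha
    · simpa using ih hw' i

/-- `Nat.Partrec'` is generated by primitive recursive functions, composition, and minimisation of
total functions. Nothing is claimed where `f` is undefined. -/
theorem computes_of_partrec {n : ℕ} {f : List.Vector ℕ n →. ℕ} (hf : Nat.Partrec' f) :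
    Computes (fun v y => y ∈ f v) := by
  induction hf with
  | prim hf =>
    simpa using computes_of_primrec hf
  | comp g _ _ ihf ihg =>
    intro x o m hx ho
    obtain ⟨P, hP⟩ := ihf.comp ihg x o m hx ho
    refine ⟨P, fun s v y hs hv hy => hP s v y hs hv ?_⟩
    obtain ⟨w, hw, hy⟩ := Part.mem_bind_iff.1 hy
    exact ⟨w, get_mem_of_mem_mOfFn hw, hy⟩
  | @rfind n f _ ihf =>
    have ihf : Computes (fun v y => y = f v) := by simpa using ihf
    intro x o m hx ho
    obtain ⟨P, hP⟩ := ihf.rfind x o m hx ho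
    refine ⟨P, fun s v y hs hv hy => hP s v y hs hv ?_⟩
    have hy' := Nat.mem_rfind.1 hy
    exact ⟨by simpa using hy'.1, fun k hk => by simpa using hy'.2 hk⟩

end LoopProg

/-! ### Loop programs as multiplication and division of a Gödel number -/

open Function (update)

/-- Iterating `f` leads from `x` to `y`. -/
def IterReaches {X : Type*} (f : X → X) (x y : X) : Prop := ∃ k, f^[k] x = y

namespace IterReaches

variable {X : Type*} {f : X → X} {x y z : X}

theorem refl (f : X → X) (x : X) : IterReaches f x x := ⟨0, rfl⟩

theorem trans (h : IterReaches f x y) (h' : IterReaches f y z) : IterReaches f x z := by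
  obtain ⟨k, rfl⟩ := h
  obtain ⟨l, rfl⟩ := h'
  exact ⟨l + k, Function.iterate_add_apply f l k x⟩

theorem head (h : f x = y) (h' : IterReaches f y z) : IterReaches f x z :=
  trans ⟨1, h⟩ h'

end IterReaches

/-- An instruction of a machine that manipulates a natural number `N`: if `den ∣ N`, multiply `N`
by `num / den` and go to `yes`, otherwise go to `no`. -/
structure FracInstr (T : Type*) where
  num : ℕ
  den : ℕ
  yes : T
  no : T

/-- The step function of the machine with the instructions `δ`. -/
def fracStep {T : Type*} (δ : T → FracInstr T) (c : T × ℕ) : T × ℕ :=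
  if (δ c.1).den ∣ c.2 then ((δ c.1).yes, c.2 / (δ c.1).den * (δ c.1).num) else ((δ c.1).no, c.2)

/-- Gödel encoding of the contents of the registers below `K`. -/
noncomputable def godel (K : ℕ) (s : ℕ → ℕ) : ℕ :=
  ∏ i ∈ Finset.range K, Nat.nth Nat.Prime i ^ s i

/-- This turns an increment into a multiplication and the decrement of a loop into a division. -/
theorem godel_update_succ {K r : ℕ} (hr : r < K) (s : ℕ → ℕ) (n : ℕ) :
    godel K (update s r (n + 1)) = godel K (update s r n) * Nat.nth Nat.Prime r := by
  unfold godel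
  rw [← Finset.mul_prod_erase _ _ (Finset.mem_range.2 hr),
    ← Finset.mul_prod_erase _ (fun i => _ ^ update s r n i) (Finset.mem_range.2 hr)]
  have : ∀ m, ∏ i ∈ (Finset.range K).erase r, Nat.nth Nat.Prime i ^ update s r m i =
      ∏ i ∈ (Finset.range K).erase r, Nat.nth Nat.Prime i ^ s i := fun m =>
    Finset.prod_congr rfl fun i hi => by rw [Function.update_of_ne (Finset.ne_of_mem_erase hi)]
  rw [this, this]
  simp only [Function.update_self, pow_succ]
  ring

/-- A prime dividing the product divides one of its factors, hence occurs with positive exponent.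
Divisibility is therefore the test for zero. -/
theorem not_dvd_godel {K r : ℕ} {s : ℕ → ℕ} (hs : s r = 0) :
    ¬ Nat.nth Nat.Prime r ∣ godel K s := by
  have hp : ∀ i, (Nat.nth Nat.Prime i).Prime := Nat.prime_nth_prime
  intro h
  obtain ⟨i, -, hi⟩ := (hp r).prime.exists_mem_finset_dvd h
  have hri := (Nat.prime_dvd_prime_iff_eq (hp r) (hp i)).1 ((hp r).dvd_of_dvd_pow hi)
  obtain rfl := Nat.nth_injective Nat.infinite_setOfPred_prime hri
  rw [hs, pow_zero] at hi
  exact (hp r).one_lt.ne' (Nat.dvd_one.1 hi)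

namespace LoopProg

/-- Control states of the machine that executes a program. -/
def State : LoopProg → Type
  | skip => Unit
  | inc _ => Unit
  | seq P Q => P.State ⊕ Q.State
  | loop _ P => Option P.State

/-- The state in which the execution of a program starts. -/
def entry : (P : LoopProg) → P.State
  | skip => ()
  | inc _ => ()
  | seq P _ => .inl P.entry
  | loop _ _ => none

instance instFiniteState : (P : LoopProg) → Finite P.State
  | skip => inferInstanceAs (Finite Unit)
  | inc _ => inferInstanceAs (Finite Unit)
  | seq P Q =>
    have := instFiniteState P
    have := instFiniteState Q
    inferInstanceAs (Finite (P.State ⊕ Q.State))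
  | loop _ P =>
    have := instFiniteState P
    inferInstanceAs (Finite (Option P.State))

/-- The instructions that execute a program as a part of a machine with states `T`, where `emb`
embeds the states and `exit` is the state in which the execution ends. -/
noncomputable def instr {T : Type} : (P : LoopProg) → (P.State → T) → T → P.State → FracInstr T
  | skip, _, exit => fun _ => ⟨1, 1, exit, exit⟩
  | inc r, _, exit => fun _ => ⟨Nat.nth Nat.Prime r, 1, exit, exit⟩
  | seq P Q, emb, exit =>
    Sum.elim (P.instr (fun q => emb (.inl q)) (emb (.inr Q.entry)))
      (Q.instr (fun q => emb (.inr q)) exit)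
  | loop r P, emb, exit => fun q =>
    Option.elim q ⟨1, Nat.nth Nat.Prime r, emb (some P.entry), exit⟩
      (P.instr (fun q => emb (some q)) (emb none))

/-- Positivity is what lets the two-counter loops for division and for its reversal terminate. -/
theorem instr_pos {T : Type} (P : LoopProg) (emb : P.State → T) (exit : T) (q : P.State) :
    0 < (P.instr emb exit q).num ∧ 0 < (P.instr emb exit q).den := by
  induction P generalizing exit with
  | skip => exact ⟨one_pos, one_pos⟩
  | inc r => exact ⟨(Nat.prime_nth_prime r).pos, one_pos⟩
  | seq P Q ihP ihQ =>
    cases q with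
    | inl q => exact ihP _ _ q
    | inr q => exact ihQ _ _ q
  | loop r P ih =>
    cases q with
    | none => exact ⟨one_pos, (Nat.prime_nth_prime r).pos⟩
    | some q => exact ih _ _ q

/-- All registers of the program are below this bound. -/
def regBound : LoopProg → ℕ
  | skip => 0
  | inc r => r + 1
  | seq P Q => max P.regBound Q.regBound
  | loop r P => max (r + 1) P.regBound

/-- Induction on the execution, not on the program, handles repeated loop rounds. The embedding and
the exit state are arbitrary so that subprograms can be treated in place. -/
theorem Exec.iterReaches {P : LoopProg} {s s' : ℕ → ℕ} (h : Exec P s s') {K : ℕ}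
    (hK : P.regBound ≤ K) {T : Type} {δ : T → FracInstr T} {emb : P.State → T} {exit : T}
    (hδ : ∀ q, δ (emb q) = P.instr emb exit q) :
    IterReaches (fracStep δ) (emb P.entry, godel K s) (exit, godel K s') := by
  induction h generalizing exit with
  | skip s =>
    refine .head ?_ (.refl _ _)
    simp [fracStep, hδ, instr]
  | inc r s =>
    refine .head ?_ (.refl _ _)
    simp only [fracStep, hδ, instr, one_dvd, if_true, Nat.div_one]
    rw [godel_update_succ (Nat.lt_of_succ_le hK), Function.update_eq_self]
  | seq _ _ ihP ihQ =>
    simp only [regBound, max_le_iff] at hK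
    exact (ihP hK.1 (emb := fun q => emb (.inl q)) fun q => hδ (.inl q)).trans
      (ihQ hK.2 (emb := fun q => emb (.inr q)) fun q => hδ (.inr q))
  | @loop_zero r P s hs =>
    refine .head ?_ (.refl _ _)
    have h := hδ (none : Option P.State)
    simp only [instr, Option.elim_none] at h
    simp only [fracStep, entry, h]
    rw [if_neg (not_dvd_godel hs)]
  | @loop_succ r P s s' s'' n hs _ _ ihP ihL =>
    have h := hδ (none : Option P.State)
    simp only [instr, Option.elim_none] at h
    have hK' := hK
    simp only [regBound, max_le_iff] at hK'
    have hN : godel K s = godel K (update s r n) * Nat.nth Nat.Prime r := by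
      rw [← godel_update_succ hK'.1, ← hs, Function.update_eq_self]
    refine .head (y := (emb (some P.entry), godel K (update s r n))) ?_
      ((ihP hK'.2 (emb := fun q => emb (some q)) fun q => hδ (some q)).trans (ihL hK hδ))
    simp only [fracStep, entry, h]
    rw [if_pos (hN ▸ Dvd.intro_left _ rfl), hN, mul_one,
      Nat.mul_div_cancel _ (Nat.prime_nth_prime r).pos]

end LoopProg

/-! ### Two-counter machines -/

/-- A machine with `k` counters. In state `q` it adds `eff q` to the counters and goes to `yes q`,
if no counter becomes negative, and otherwise goes to `no q`. -/
structure TryMachine (Q : Type*) (k : ℕ) where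
  eff : Q → Fin k → ℤ
  yes : Q → Q
  no : Q → Q

namespace TryMachine

variable {Q : Type*} {k : ℕ}

/-- The attempted addition succeeds in the configuration `c`. -/
def Succeeds (M : TryMachine Q k) (c : Q × (Fin k → ℕ)) : Prop :=
  ∀ i, 0 ≤ (c.2 i : ℤ) + M.eff c.1 i

open Classical in
/-- The step function of a machine. -/
noncomputable def step (M : TryMachine Q k) (c : Q × (Fin k → ℕ)) : Q × (Fin k → ℕ) :=
  if M.Succeeds c then (M.yes c.1, fun i => ((c.2 i : ℤ) + M.eff c.1 i).toNat) else (M.no c.1, c.2)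

theorem step_two_yes (M : TryMachine Q 2) {q : Q} {x y x' y' : ℕ}
    (hx : (x' : ℤ) = x + M.eff q 0) (hy : (y' : ℤ) = y + M.eff q 1) :
    M.step (q, ![x, y]) = (M.yes q, ![x', y']) := by
  have h : M.Succeeds (q, ![x, y]) := fun i => by
    fin_cases i <;> simp <;> omega
  rw [step, if_pos h]
  refine Prod.ext rfl (funext fun i => ?_)
  fin_cases i <;> simp <;> omega

theorem step_two_no (M : TryMachine Q 2) {q : Q} {x y : ℕ}
    (h : (x : ℤ) + M.eff q 0 < 0 ∨ (y : ℤ) + M.eff q 1 < 0) :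
    M.step (q, ![x, y]) = (M.no q, ![x, y]) := by
  rw [step, if_neg]
  intro hs
  have h0 := hs 0
  have h1 := hs 1
  simp at h0 h1
  omega

/-- The two-counter machine that executes the instructions `δ` on the first counter. -/
def ofFrac {T : Type*} (δ : T → FracInstr T) : TryMachine (T × Fin 5) 2 where
  -- Phase 0 divides by `den` into the second counter, scaling by `num`; phase 1 tests whether the
  -- remainder is positive. If so, phase 2 undoes the test and phase 3 the division. If not, phase 4
  -- moves the result back to the first counter.
  eff q := ![![-((δ q.1).den : ℤ), (δ q.1).num], ![-1, 0], ![1, 0],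
    ![((δ q.1).den : ℤ), -((δ q.1).num : ℤ)], ![1, -1]] q.2
  yes q := ![(q.1, 0), (q.1, 2), (q.1, 3), (q.1, 3), (q.1, 4)] q.2
  no q := ![(q.1, 1), (q.1, 4), (q.1, 3), ((δ q.1).no, 0), ((δ q.1).yes, 0)] q.2

variable {T : Type*} {δ : T → FracInstr T} {q : T}

theorem ofFrac_divide (n r y : ℕ) (hr : r < (δ q).den) :
    IterReaches (ofFrac δ).step ((q, 0), ![n * (δ q).den + r, y])
      ((q, 1), ![r, y + n * (δ q).num]) := by
  induction n generalizing y with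
  | zero =>
    refine .head (step_two_no _ ?_) (by simpa [ofFrac] using .refl _ _)
    left
    simp [ofFrac]
    omega
  | succ n ih =>
    refine .head (step_two_yes _ (x' := n * (δ q).den + r) (y' := y + (δ q).num) ?_ ?_) ?_
    · simp [ofFrac]
      ring
    · simp [ofFrac]
    · have h := ih (y + (δ q).num)
      have e : y + (δ q).num + n * (δ q).num = y + (n + 1) * (δ q).num := by ring
      rw [e] at h
      exact h

/-- With `num` positive, the attempt fails exactly when the second counter is empty, after `n`
rounds. -/
theorem ofFrac_restore (hn : 0 < (δ q).num) (n x : ℕ) :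
    IterReaches (ofFrac δ).step ((q, 3), ![x, n * (δ q).num])
      (((δ q).no, 0), ![x + n * (δ q).den, 0]) := by
  induction n generalizing x with
  | zero =>
    refine .head (step_two_no _ ?_) (by simpa [ofFrac] using .refl _ _)
    right
    simp [ofFrac]
    omega
  | succ n ih =>
    refine .head (step_two_yes _ (x' := x + (δ q).den) (y' := n * (δ q).num) ?_ ?_) ?_
    · simp [ofFrac]
    · simp [ofFrac]
      ring
    · have h := ih (x + (δ q).den)
      have e : x + (δ q).den + n * (δ q).den = x + (n + 1) * (δ q).den := by ring
      rw [e] at h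
      exact h

theorem ofFrac_transfer (n x : ℕ) :
    IterReaches (ofFrac δ).step ((q, 4), ![x, n]) (((δ q).yes, 0), ![x + n, 0]) := by
  induction n generalizing x with
  | zero =>
    refine .head (step_two_no _ ?_) (by simpa [ofFrac] using .refl _ _)
    right
    simp [ofFrac]
  | succ n ih =>
    refine .head (step_two_yes _ (x' := x + 1) (y' := n) ?_ ?_) ?_
    · simp [ofFrac]
    · simp [ofFrac]
    · have h := ih (x + 1)
      have e : x + 1 + n = x + (n + 1) := by ring
      rw [e] at h
      exact h

/-- After the division, the counters hold the remainder and `num` times the quotient. The remainder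
decides between transferring the result and restoring `N`. -/
theorem ofFrac_step (hn : 0 < (δ q).num) (hd : 0 < (δ q).den) (N : ℕ) :
    IterReaches (ofFrac δ).step ((q, 0), ![N, 0])
      (((fracStep δ (q, N)).1, 0), ![(fracStep δ (q, N)).2, 0]) := by
  have h := ofFrac_divide (N / (δ q).den) (N % (δ q).den) 0 (Nat.mod_lt _ hd)
  rw [Nat.div_add_mod', Nat.zero_add] at h
  refine h.trans ?_
  by_cases hdvd : (δ q).den ∣ N
  · have e : fracStep δ (q, N) = ((δ q).yes, N / (δ q).den * (δ q).num) := if_pos hdvd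
    rw [e, Nat.mod_eq_zero_of_dvd hdvd]
    refine .head (step_two_no _ ?_) ?_
    · left
      simp [ofFrac]
    · have h := ofFrac_transfer (δ := δ) (q := q) (N / (δ q).den * (δ q).num) 0
      rw [Nat.zero_add] at h
      exact h
  · have e : fracStep δ (q, N) = ((δ q).no, N) := if_neg hdvd
    rw [e]
    have hpos : N % (δ q).den ≠ 0 := fun h0 => hdvd (Nat.dvd_of_mod_eq_zero h0)
    refine .head (step_two_yes _ (x' := N % (δ q).den - 1)
      (y' := N / (δ q).den * (δ q).num) ?_ ?_) ?_
    · simp [ofFrac]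
      omega
    · simp [ofFrac]
    refine .head (step_two_yes _ (x' := N % (δ q).den)
      (y' := N / (δ q).den * (δ q).num) ?_ ?_) ?_
    · simp [ofFrac]
      omega
    · simp [ofFrac]
    · have h := ofFrac_restore hn (N / (δ q).den) (N % (δ q).den)
      rw [Nat.mod_add_div'] at h
      exact h

theorem ofFrac_iterReaches (hδ : ∀ q, 0 < (δ q).num ∧ 0 < (δ q).den) {c d : T × ℕ}
    (h : IterReaches (fracStep δ) c d) :
    IterReaches (ofFrac δ).step ((c.1, 0), ![c.2, 0]) ((d.1, 0), ![d.2, 0]) := by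
  obtain ⟨k, rfl⟩ := h
  induction k generalizing c with
  | zero => exact .refl _ _
  | succ k ih => exact (ofFrac_step (hδ _).1 (hδ _).2 _).trans ih

/-- A set of states that is closed under both kinds of steps is not left. -/
theorem iterate_step_mem (M : TryMachine Q k) {S : Set Q}
    (hS : ∀ q ∈ S, M.yes q ∈ S ∧ M.no q ∈ S) {c : Q × (Fin k → ℕ)} (hc : c.1 ∈ S) (j : ℕ) :
    (M.step^[j] c).1 ∈ S := by
  induction j generalizing c with
  | zero => exact hc
  | succ j ih =>
    refine ih (c := M.step c) ?_
    rw [step]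
    split_ifs
    exacts [(hS _ hc).1, (hS _ hc).2]

/-- Every partial recursive function `f` is evaluated by a two-counter machine, in the sense that
started with `2 ^ n` in the first counter, it reaches the state `h` if `0 < f n`, and does not
reach it if `f n = 0`. -/
theorem exists_of_partrec {f : ℕ →. ℕ} (hf : Partrec f) :
    ∃ (Q : Type) (_ : Finite Q) (M : TryMachine Q 2) (q₀ h : Q), ∀ n y, y ∈ f n →
      ((∃ j, (M.step^[j] (q₀, ![2 ^ n, 0])).1 = h) ↔ y ≠ 0) := by
  -- Input in register `0`, output in register `1`, free registers from `2` on.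
  obtain ⟨P, hP⟩ := LoopProg.computes_of_partrec (Nat.Partrec'.part_iff₁.2 hf) (fun _ => 0) 1 2
    (by simp) (by simp)
  let T := P.State ⊕ Fin 3
  -- State `.inr 0` tests the output register through its prime; `.inr 1` and `.inr 2` are traps for
  -- a positive and a zero output.
  let δ : T → FracInstr T := Sum.elim (P.instr .inl (.inr 0))
    ![⟨1, Nat.nth Nat.Prime 1, .inr 1, .inr 2⟩, ⟨1, 1, .inr 1, .inr 1⟩, ⟨1, 1, .inr 2, .inr 2⟩]
  have hδ : ∀ q, 0 < (δ q).num ∧ 0 < (δ q).den := by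
    rintro (q | q)
    · exact P.instr_pos _ _ q
    · fin_cases q <;> simp [δ]
  have closed : ∀ i : Fin 3, i ≠ 0 → ∀ q ∈ {q : T × Fin 5 | q.1 = .inr i},
      (ofFrac δ).yes q ∈ {q : T × Fin 5 | q.1 = .inr i} ∧
      (ofFrac δ).no q ∈ {q : T × Fin 5 | q.1 = .inr i} := by
    rintro i hi ⟨_, j⟩ rfl
    fin_cases i
    · exact absurd rfl hi
    all_goals fin_cases j <;> simp [ofFrac, δ]
  refine ⟨T × Fin 5, inferInstance, ofFrac δ, (.inl P.entry, 0), (.inr 1, 0), fun n y hy => ?_⟩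
  have run := ofFrac_iterReaches hδ ((hP (update (fun _ => 0) 0 n) (n ::ᵥ .nil) y
    (fun r hr => Function.update_of_ne (by omega) _ _)
    (fun i => by rw [Subsingleton.elim i 0]; simp) (by simpa using hy)).iterReaches
    (K := max 2 P.regBound) (le_max_right _ _) (δ := δ) (emb := .inl) (exit := .inr 0)
    fun q => rfl)
  have hN : godel (max 2 P.regBound) (update (fun _ => 0) 0 n) = 2 ^ n := by
    unfold godel
    rw [Finset.prod_eq_single 0]
    · simp [Nat.nth_prime_zero_eq_two]
    · intro b _ hb
      simp [hb]
    · simp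
  have run' : IterReaches (ofFrac δ).step ((.inl P.entry, 0), ![2 ^ n, 0]) _ := hN ▸ run
  have last := ofFrac_step (hδ _).1 (hδ _).2 (δ := δ) (q := .inr 0)
    (godel (max 2 P.regBound) (update (update (fun _ => 0) 0 n) 1 y))
  constructor
  · rintro ⟨j, hj⟩ rfl
    have e : fracStep δ (.inr 0, godel (max 2 P.regBound) (update (update (fun _ => 0) 0 n) 1 0)) =
        (.inr 2, _) := if_neg (not_dvd_godel (by simp))
    rw [e] at last
    obtain ⟨l, hl⟩ := run'.trans last
    -- Both traps would be visited, and whichever is entered first is never left.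
    rcases le_total j l with hjl | hlj
    · have := iterate_step_mem (ofFrac δ) (closed 1 (by simp)) (c := (ofFrac δ).step^[j] _)
        (by rw [hj]; rfl) (l - j)
      rw [← Function.iterate_add_apply, Nat.sub_add_cancel hjl, hl] at this
      exact absurd (Sum.inr.inj this) (by decide)
    · have := iterate_step_mem (ofFrac δ) (closed 2 (by simp)) (c := (ofFrac δ).step^[l] _)
        (by rw [hl]; rfl) (j - l)
      rw [← Function.iterate_add_apply, Nat.sub_add_cancel hlj, hj] at this
      exact absurd (Sum.inr.inj this) (by decide)
  · intro hy0
    obtain ⟨y, rfl⟩ := Nat.exists_eq_succ_of_ne_zero hy0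
    have e : fracStep δ (.inr 0,
        godel (max 2 P.regBound) (update (update (fun _ => 0) 0 n) 1 (y + 1))) =
        (.inr 1, _) := if_pos (by
      rw [godel_update_succ (by simp)]
      exact Dvd.intro_left _ rfl)
    rw [e] at last
    obtain ⟨l, hl⟩ := run'.trans last
    exact ⟨l, by rw [hl]⟩

end TryMachine

/-! ### Criteria for simulation and history-determinism -/

namespace VASS

section General

variable {α : Type*} {k : ℕ}

/-- Some transition over `x` leads from `c` to `d`. -/
def Fires (V : VASS α k) (c : V.Config) (x : α) (d : V.Config) : Prop :=
  ∃ t, V.Step c t d ∧ t.letter = x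

/-- Some run from `c` reads the word. -/
def Reads (V : VASS α k) : V.Config → List α → Prop
  | _, [] => True
  | c, x :: w => ∃ d, V.Fires c x d ∧ V.Reads d w

theorem Step.unique {V : VASS α k} {c d d' : V.Config} {t : V.Trans} (h : V.Step c t d)
    (h' : V.Step c t d') : d = d' := by
  refine Prod.ext (h.2.2.1.trans h'.2.2.1.symm) (funext fun i => ?_)
  have h1 := h.2.2.2 i
  have h2 := h'.2.2.2 i
  omega

/-- Histories of the simulation game record only transitions; this recovers the configurations from
them. -/
theorem IsRun.unique {V : VASS α k} {ρ : List V.Trans} {c d d' : V.Config} (h : V.IsRun c ρ d)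
    (h' : V.IsRun c ρ d') : d = d' := by
  induction ρ generalizing c with
  | nil => exact Eq.trans (Eq.symm h) h'
  | cons t ρ ih =>
    obtain ⟨e, he, h⟩ := h
    obtain ⟨e', he', h'⟩ := h'
    obtain rfl := he.unique he'
    exact ih h h'

theorem IsRun.concat {V : VASS α k} {ρ : List V.Trans} {t : V.Trans} {c d e : V.Config}
    (h : V.IsRun c ρ d) (ht : V.Step d t e) : V.IsRun c (ρ ++ [t]) e := by
  induction ρ generalizing c with
  | nil =>
    obtain rfl : c = d := h
    exact ⟨e, ht, rfl⟩
  | cons t' ρ ih =>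
    obtain ⟨d', hd', h⟩ := h
    exact ⟨d', hd', ih h⟩

theorem reads_iff {V : VASS α k} {c : V.Config} {w : List α} :
    V.Reads c w ↔ ∃ ρ d, V.IsRun c ρ d ∧ ρ.map VASSTransition.letter = w := by
  induction w generalizing c with
  | nil => exact ⟨fun _ => ⟨[], c, rfl, rfl⟩, fun _ => trivial⟩
  | cons x w ih =>
    constructor
    · rintro ⟨d, ⟨t, ht, rfl⟩, hd⟩
      obtain ⟨ρ, e, hρ, rfl⟩ := ih.1 hd
      exact ⟨t :: ρ, e, ⟨d, ht, hρ⟩, rfl⟩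
    · rintro ⟨_ | ⟨t, ρ⟩, e, hρ, hw⟩
      · simp at hw
      · obtain ⟨d, ht, hρ⟩ := hρ
        rw [List.map_cons, List.cons.injEq] at hw
        exact ⟨d, ⟨t, ht, hw.1⟩, ih.2 ⟨ρ, e, hρ, hw.2⟩⟩

theorem mem_traceLanguage_iff {V : VASS α k} {w : List α} :
    w ∈ V.traceLanguage ↔ V.Reads V.init w := reads_iff.symm

/-- A relation between the configurations that is preserved by rounds of the simulation game
yields a strategy for Duplicator. -/
theorem simulates_of_relation {V₀ V₁ : VASS α k} (Rel : V₁.Config → V₀.Config → Prop)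
    (h₀ : Rel V₁.init V₀.init)
    (hRel : ∀ s d x s', Rel s d → V₁.Fires s x s' → ∃ d', V₀.Fires d x d' ∧ Rel s' d') :
    V₀.Simulates V₁ := by
  classical
  let Good (h : List (V₁.Trans × V₀.Trans)) (t : V₁.Trans) (t' : V₀.Trans) : Prop :=
    ∀ s d s', V₁.IsRun V₁.init (h.map Prod.fst) s → V₀.IsRun V₀.init (h.map Prod.snd) d →
      V₁.Step s t s' → t'.letter = t.letter ∧ ∃ d', V₀.Step d t' d' ∧ Rel s' d'
  -- The default answer only makes the strategy total; it is never given in plays that follow the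
  -- strategy.
  let σ : DuplicatorStrategy V₀ V₁ := fun h t =>
    if H : ∃ t', Good h t t' then H.choose else ⟨V₀.init.1, t.letter, 0, V₀.init.1⟩
  have good : ∀ h s d t s', V₁.IsRun V₁.init (h.map Prod.fst) s →
      V₀.IsRun V₀.init (h.map Prod.snd) d → Rel s d → V₁.Step s t s' → Good h t (σ h t) := by
    intro h s d t s' hs hd hsd ht
    have H : ∃ t', Good h t t' := by
      obtain ⟨d', ⟨t', ht', hl⟩, hR⟩ := hRel s d t.letter s' hsd ⟨t, ht, rfl⟩
      refine ⟨t', fun s₁ d₁ s₁' hs₁ hd₁ ht₁ => ?_⟩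
      obtain rfl := hs.unique hs₁
      obtain rfl := hd.unique hd₁
      obtain rfl := ht.unique ht₁
      exact ⟨hl, d', ht', hR⟩
    simp only [σ, dif_pos H]
    exact H.choose_spec
  have inv : ∀ h s d, PlayReaches V₀ V₁ σ h s d → V₁.IsRun V₁.init (h.map Prod.fst) s ∧
      V₀.IsRun V₀.init (h.map Prod.snd) d ∧ Rel s d := by
    intro h s d hp
    induction hp with
    | start => exact ⟨rfl, rfl, h₀⟩
    | @round h s s' d d' t _ ht _ ht' ih =>
      obtain ⟨hs, hd, hsd⟩ := ih
      obtain ⟨-, d₁, hd₁, hR⟩ := good h s d t s' hs hd hsd ht s d s' hs hd ht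
      obtain rfl := ht'.unique hd₁
      simp only [List.map_append, List.map_cons, List.map_nil]
      exact ⟨hs.concat ht, hd.concat ht', hR⟩
  refine ⟨σ, fun h s d hp t s' ht => ?_⟩
  obtain ⟨hs, hd, hsd⟩ := inv h s d hp
  obtain ⟨hl, d', hd', -⟩ := good h s d t s' hs hd hsd ht s d s' hs hd ht
  exact ⟨hl, d', hd'⟩

theorem AllAccepting.accepting {V : VASS α k} (hV : V.AllAccepting) (c : V.Config) :
    V.Accepting c :=
  ⟨(c.1, 0), (hV _).2 rfl, rfl, fun _ => Nat.zero_le _⟩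

/-- If all configurations are accepting, then it suffices for history-determinism that for each
letter some successor reads all words that are read by the other ones. -/
theorem AllAccepting.isHistoryDeterministic {V : VASS α k} (hV : V.AllAccepting)
    (I : V.Config → Prop) (h₀ : I V.init)
    (hI : ∀ c x, I c → (∃ d, V.Fires c x d) → ∃ d, V.Fires c x d ∧ I d ∧
      ∀ d' w, V.Fires c x d' → V.Reads d' w → V.Reads d w) :
    V.IsHistoryDeterministic := by
  classical
  let Best (c : V.Config) (x : α) (t : V.Trans) : Prop := ∃ d, V.Step c t d ∧ t.letter = x ∧ I d ∧
      ∀ d' w, V.Fires c x d' → V.Reads d' w → V.Reads d w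
  -- The second case is needed outside `I`, because a resolver must answer in every configuration
  -- with an enabled transition.
  let r : List (V.Config × V.Trans) → V.Config → α → Option V.Trans := fun _ c x =>
    if H : ∃ t, Best c x t then some H.choose
    else if H : ∃ t, V.EnabledOver c x t then some H.choose else none
  refine ⟨r, fun h c x => ⟨fun t ht => ?_, fun H => ?_⟩, fun w hw => ?_⟩
  · simp only [r] at ht
    split_ifs at ht with H H'
    · obtain rfl := Option.some.inj ht
      obtain ⟨d, hd, hl, -⟩ := H.choose_spec
      exact ⟨hl, d, hd⟩
    · obtain rfl := Option.some.inj ht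
      exact H'.choose_spec
  · simp only [r]
    split_ifs
    exacts [⟨_, rfl⟩, ⟨_, rfl⟩]
  · have main : ∀ (w : List α) (h : List (V.Config × V.Trans)) (c : V.Config), I c → V.Reads c w →
        ∃ d, V.ResolverRun r h c w d := by
      intro w
      induction w with
      | nil => exact fun h c _ _ => ⟨c, rfl⟩
      | cons x w ih =>
        rintro h c hc ⟨d', hd', hw⟩
        have H : ∃ t, Best c x t := by
          obtain ⟨d, ⟨t, ht, hl⟩, hId, hd⟩ := hI c x hc ⟨d', hd'⟩
          exact ⟨t, d, ht, hl, hId, hd⟩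
        obtain ⟨d, hd, -, hId, hbest⟩ := H.choose_spec
        obtain ⟨e, he⟩ := ih (h ++ [(c, H.choose)]) d hId (hbest d' w hd' hw)
        exact ⟨e, H.choose, d, dif_pos H, hd, he⟩
    obtain ⟨ρ, c, hρ, hl, -⟩ := hw
    obtain ⟨d, hd⟩ := main w [] V.init h₀ (reads_iff.2 ⟨ρ, c, hρ, hl⟩)
    exact ⟨d, hd, hV.accepting d⟩

end General

/-! ### VASSs over arbitrary finite state types -/

section OfTransitions

variable {α S : Type*} [Finite S] {k : ℕ}

/-- Rename the states of a transition. -/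
def _root_.VASSTransition.mapState {S' : Type*} (e : S → S') (t : VASSTransition S α k) :
    VASSTransition S' α k :=
  ⟨e t.src, t.letter, t.eff, e t.tgt⟩

open Classical in
/-- The VASS with the transitions `T` over an arbitrary finite set of states and with initial
configuration `c₀`, in which all configurations are accepting. -/
noncomputable def ofTransitions {T : Set (VASSTransition S α k)} (hT : T.Finite)
    (c₀ : S × (Fin k → ℕ)) : VASS α k where
  numStates := Nat.card S
  init := (Finite.equivFin S c₀.1, c₀.2)
  final := Finset.univ.image fun q => (q, 0)
  trans := hT.toFinset.image (VASSTransition.mapState (Finite.equivFin S))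

variable {T : Set (VASSTransition S α k)} {hT : T.Finite} {c₀ : S × (Fin k → ℕ)}

variable (hT c₀) in
/-- The configurations of `ofTransitions hT c₀`. -/
noncomputable def conf : S × (Fin k → ℕ) ≃ (ofTransitions hT c₀).Config :=
  (Finite.equivFin S).prodCongr (Equiv.refl _)

theorem allAccepting_ofTransitions : (ofTransitions hT c₀).AllAccepting := by
  intro c
  refine Finset.mem_image.trans ⟨?_, fun h => ⟨c.1, Finset.mem_univ _, Prod.ext rfl h.symm⟩⟩
  rintro ⟨q, -, rfl⟩
  rfl

theorem mem_trans_ofTransitions {t : (ofTransitions hT c₀).Trans} :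
    t ∈ (ofTransitions hT c₀).trans ↔ ∃ t' ∈ T, t'.mapState (Finite.equivFin S) = t := by
  classical
  refine (Finset.mem_image (β := VASSTransition (Fin (Nat.card S)) α k)).trans ?_
  simp only [Set.Finite.mem_toFinset]

theorem init_ofTransitions : (ofTransitions hT c₀).init = conf hT c₀ c₀ := rfl

/-- Some transition in `T` over `x` leads from `c` to `d`. -/
def FiresIn (T : Set (VASSTransition S α k)) (c : S × (Fin k → ℕ)) (x : α)
    (d : S × (Fin k → ℕ)) : Prop :=
  ∃ t ∈ T, t.letter = x ∧ c.1 = t.src ∧ d.1 = t.tgt ∧ ∀ i, (d.2 i : ℤ) = (c.2 i : ℤ) + t.eff i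

theorem fires_ofTransitions {c d : S × (Fin k → ℕ)} {x : α} :
    (ofTransitions hT c₀).Fires (conf hT c₀ c) x (conf hT c₀ d) ↔ FiresIn T c x d := by
  constructor
  · rintro ⟨t, ⟨ht, hs, htgt, heff⟩, rfl⟩
    obtain ⟨t, htT, rfl⟩ := mem_trans_ofTransitions.1 ht
    exact ⟨t, htT, rfl, (Finite.equivFin S).injective hs, (Finite.equivFin S).injective htgt, heff⟩
  · rintro ⟨t, ht, hl, hs, htgt, heff⟩
    exact ⟨t.mapState (Finite.equivFin S), ⟨mem_trans_ofTransitions.2 ⟨t, ht, rfl⟩,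
      congrArg _ hs, congrArg _ htgt, heff⟩, hl⟩

theorem isDeterministic_ofTransitions
    (h : ∀ t ∈ T, ∀ t' ∈ T, t.src = t'.src → t.letter = t'.letter → t = t') :
    (ofTransitions hT c₀).IsDeterministic := by
  intro t ht t' ht' hs hl
  obtain ⟨t, htT, rfl⟩ := mem_trans_ofTransitions.1 ht
  obtain ⟨t', htT', rfl⟩ := mem_trans_ofTransitions.1 ht'
  rw [h t htT t' htT' ((Finite.equivFin S).injective hs) hl]

end OfTransitions

end VASS

/-! ### The deterministic and the history-deterministic VASS of a machine -/

namespace TryMachine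

open VASS

variable {α Q : Type*} {k : ℕ}

/-- The transitions of the deterministic VASS that executes a machine: the letter `b` claims that
an addition succeeds, and the letter `a` claims that it fails, which is not checked. -/
def honestTrans (M : TryMachine Q k) (a b : α) : Set (VASSTransition Q α k) :=
  Set.range (fun q => ⟨q, b, M.eff q, M.yes q⟩) ∪ Set.range (fun q => ⟨q, a, 0, M.no q⟩)

/-- What has to be added to the counters after a false claim has been detected. -/
def debt (M : TryMachine Q k) : Option (Option Q) → Fin k → ℤ
  | some (some q) => -M.eff q
  | _ => 0

/-- The transitions of the history-deterministic VASS for a machine with halting state `h`. In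
states `(none, q)` it executes the machine and stops in `h`, and false claims that an addition
fails can be detected. Afterwards, in states `(some _, q)`, it behaves as the deterministic VASS. -/
def detectTrans (M : TryMachine Q k) (h : Q) (a b : α) :
    Set (VASSTransition (Option (Option Q) × Q) α k) :=
  Set.range (fun q : {q // q ≠ h} => ⟨(none, q), b, M.eff q, (none, M.yes q)⟩) ∪
  Set.range (fun q : {q // q ≠ h} => ⟨(none, q), a, 0, (none, M.no q)⟩) ∪
  -- Detection: the addition that `a` denies is fired, and remembering `q` records that it has to be
  -- undone.
  Set.range (fun q : {q // q ≠ h} => ⟨(none, q), a, M.eff q, (some (some q.1), M.no q)⟩) ∪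
  Set.range (fun p : Option Q × Q =>
    ⟨(some p.1, p.2), b, M.eff p.2 + M.debt (some p.1), (some none, M.yes p.2)⟩) ∪
  Set.range (fun p : Option Q × Q =>
    ⟨(some p.1, p.2), a, M.debt (some p.1), (some none, M.no p.2)⟩)

/-- The configuration reached if the addition succeeds. -/
def fire (M : TryMachine Q k) (c : Q × (Fin k → ℕ)) : Q × (Fin k → ℕ) :=
  (M.yes c.1, fun i => ((c.2 i : ℤ) + M.eff c.1 i).toNat)

variable {M : TryMachine Q k} {h : Q} {a b : α}

theorem firesIn_honestTrans {c d : Q × (Fin k → ℕ)} {x : α} :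
    FiresIn (M.honestTrans a b) c x d ↔
      (x = b ∧ M.Succeeds c ∧ d = M.fire c) ∨ (x = a ∧ d = (M.no c.1, c.2)) := by
  constructor
  · rintro ⟨t, ⟨q, rfl⟩ | ⟨q, rfl⟩, rfl, hs, ht, he⟩ <;> simp only at hs ht he <;> subst hs
    · refine .inl ⟨rfl, fun i => he i ▸ Int.natCast_nonneg _, Prod.ext ht (funext fun i => ?_)⟩
      simp [fire, ← he i]
    · refine .inr ⟨rfl, Prod.ext ht (funext fun i => ?_)⟩
      simpa using he i
  · rintro (⟨rfl, hc, rfl⟩ | ⟨rfl, rfl⟩)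
    · exact ⟨_, .inl ⟨c.1, rfl⟩, rfl, rfl, rfl, fun i => Int.toNat_of_nonneg (hc i)⟩
    · exact ⟨_, .inr ⟨c.1, rfl⟩, rfl, rfl, rfl, fun i => by simp⟩

theorem firesIn_honestTrans_unique (hab : a ≠ b) {c d d' : Q × (Fin k → ℕ)} {x : α}
    (hd : FiresIn (M.honestTrans a b) c x d) (hd' : FiresIn (M.honestTrans a b) c x d') :
    d = d' := by
  rw [firesIn_honestTrans] at hd hd'
  rcases hd with ⟨rfl, -, rfl⟩ | ⟨rfl, rfl⟩ <;> rcases hd' with ⟨e, -, rfl⟩ | ⟨e, rfl⟩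
  exacts [rfl, absurd e.symm hab, absurd e hab, rfl]

/-- The configuration `c` of the deterministic VASS corresponds to the configuration `d` of the
history-deterministic one. -/
def Matches (M : TryMachine Q k) (c : Q × (Fin k → ℕ))
    (d : (Option (Option Q) × Q) × (Fin k → ℕ)) : Prop :=
  d.1.2 = c.1 ∧ ∀ i, (c.2 i : ℤ) = d.2 i + M.debt d.1.1 i

/-- Counters plus debt change exactly as in the deterministic VASS; in a detection the added effect
and the new debt cancel. -/
theorem exists_honest_of_detect {c : Q × (Fin k → ℕ)}
    {d d' : (Option (Option Q) × Q) × (Fin k → ℕ)} {x : α} (hcd : M.Matches c d)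
    (hd : FiresIn (M.detectTrans h a b) d x d') :
    ∃ c', FiresIn (M.honestTrans a b) c x c' ∧ M.Matches c' d' := by
  obtain ⟨q, u⟩ := c
  obtain ⟨⟨m, q'⟩, w⟩ := d
  obtain ⟨⟨m', q''⟩, w'⟩ := d'
  obtain ⟨hq, hu⟩ := hcd
  obtain ⟨t, (((⟨q, rfl⟩ | ⟨q, rfl⟩) | ⟨q, rfl⟩) | ⟨p, rfl⟩) | ⟨p, rfl⟩, rfl, hs, ht, he⟩ := hd <;>
    simp only [Prod.mk.injEq] at hs ht he hq hu <;> obtain ⟨rfl, rfl⟩ := hs <;>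
    obtain ⟨rfl, rfl⟩ := ht <;> subst hq
  · exact ⟨(M.yes q, w'), ⟨_, .inl ⟨q, rfl⟩, rfl, rfl, rfl, fun i => by
      simp [he, hu, debt]⟩, rfl, fun i => by simp [debt]⟩
  · exact ⟨(M.no q, u), ⟨_, .inr ⟨q, rfl⟩, rfl, rfl, rfl, fun i => by simp⟩, rfl, fun i => by
      simp [he, hu, debt]⟩
  · exact ⟨(M.no q, u), ⟨_, .inr ⟨q, rfl⟩, rfl, rfl, rfl, fun i => by simp⟩, rfl, fun i => by
      simp [he, hu, debt]⟩
  · exact ⟨(M.yes p.2, w'), ⟨_, .inl ⟨p.2, rfl⟩, rfl, rfl, rfl, fun i => by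
      simp [he, hu]; ring⟩, rfl, fun i => by simp [debt]⟩
  · exact ⟨(M.no p.2, u), ⟨_, .inr ⟨p.2, rfl⟩, rfl, rfl, rfl, fun i => by simp⟩, rfl, fun i => by
      simp [he, hu, debt]⟩

/-- After a detection the debt is repaid within the next transition. Only its result must be
non-negative, and this result is `c'`, so the debt blocks nothing. -/
theorem exists_detect_of_honest {c c' : Q × (Fin k → ℕ)}
    {d : (Option (Option Q) × Q) × (Fin k → ℕ)} {x : α} (hcd : M.Matches c d) (hd : d.1.1 ≠ none)
    (hc : FiresIn (M.honestTrans a b) c x c') :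
    ∃ d', FiresIn (M.detectTrans h a b) d x d' ∧ M.Matches c' d' ∧ d'.1.1 ≠ none := by
  obtain ⟨q, u⟩ := c
  obtain ⟨⟨m, q'⟩, w⟩ := d
  obtain ⟨rfl, hu⟩ := hcd
  obtain ⟨m, rfl⟩ := Option.ne_none_iff_exists'.1 hd
  refine ⟨((some none, c'.1), c'.2), ?_, ⟨rfl, fun i => by simp [debt]⟩, by simp⟩
  obtain ⟨t, ⟨q, rfl⟩ | ⟨q, rfl⟩, rfl, hs, ht, he⟩ := hc <;> simp only at hs ht he hu <;> subst hs
  · exact ⟨_, .inl (.inr ⟨(m, q'), rfl⟩), rfl, rfl, by rw [ht], fun i => by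
      simp [he, hu]; ring⟩
  · exact ⟨_, .inr ⟨(m, q'), rfl⟩, rfl, rfl, by rw [ht], fun i => by
      simp [he, hu]⟩

/-- The only choice is whether to detect. -/
theorem firesIn_detectTrans_unique (hab : a ≠ b)
    {d e e' : (Option (Option Q) × Q) × (Fin k → ℕ)} {x : α}
    (he : FiresIn (M.detectTrans h a b) d x e) (he' : FiresIn (M.detectTrans h a b) d x e')
    (hn : e.1.1 = none) (hn' : e'.1.1 = none) : e = e' := by
  obtain ⟨t, ht, hl, hs, htgt, heff⟩ := he
  obtain ⟨t', ht', hl', hs', htgt', heff'⟩ := he'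
  have : t = t' := by
    rcases ht with (((⟨q, rfl⟩ | ⟨q, rfl⟩) | ⟨q, rfl⟩) | ⟨p, rfl⟩) | ⟨p, rfl⟩ <;>
    rcases ht' with (((⟨q', rfl⟩ | ⟨q', rfl⟩) | ⟨q', rfl⟩) | ⟨p', rfl⟩) | ⟨p', rfl⟩ <;>
    simp_all
  subst this
  refine Prod.ext (htgt.trans htgt'.symm) (funext fun i => ?_)
  have h1 := heff i
  have h2 := heff' i
  omega

theorem matches_init (M : TryMachine Q k) (c₀ : Q × (Fin k → ℕ)) :
    M.Matches c₀ ((none, c₀.1), c₀.2) := ⟨rfl, fun i => by simp [debt]⟩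

section Finite

variable [Finite Q]

theorem finite_honestTrans (M : TryMachine Q k) (a b : α) : (M.honestTrans a b).Finite :=
  (Set.finite_range _).union (Set.finite_range _)

theorem finite_detectTrans (M : TryMachine Q k) (h : Q) (a b : α) :
    (M.detectTrans h a b).Finite :=
  ((((Set.finite_range _).union (Set.finite_range _)).union (Set.finite_range _)).union
    (Set.finite_range _)).union (Set.finite_range _)

/-- The deterministic VASS for a machine that is started in `c₀`. -/
noncomputable def honestVASS (M : TryMachine Q k) (a b : α) (c₀ : Q × (Fin k → ℕ)) : VASS α k :=
  ofTransitions (M.finite_honestTrans a b) c₀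

/-- The history-deterministic VASS for a machine that is started in `c₀`. -/
noncomputable def detectVASS (M : TryMachine Q k) (h : Q) (a b : α) (c₀ : Q × (Fin k → ℕ)) :
    VASS α k :=
  ofTransitions (M.finite_detectTrans h a b) ((none, c₀.1), c₀.2)

variable (M h) (c₀ : Q × (Fin k → ℕ))

theorem honestVASS_isDeterministic (hab : a ≠ b) : (M.honestVASS a b c₀).IsDeterministic := by
  refine isDeterministic_ofTransitions fun t ht t' ht' hs hl => ?_
  rcases ht with ⟨q, rfl⟩ | ⟨q, rfl⟩ <;> rcases ht' with ⟨q', rfl⟩ | ⟨q', rfl⟩ <;> simp_all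

theorem honestVASS_simulates_detectVASS :
    (M.honestVASS a b c₀).Simulates (M.detectVASS h a b c₀) := by
  refine simulates_of_relation (fun d c => M.Matches ((conf _ _).symm c) ((conf _ _).symm d))
    (by simpa [honestVASS, detectVASS, init_ofTransitions] using M.matches_init c₀) ?_
  intro d c x d' hcd hd
  obtain ⟨d, rfl⟩ := (conf _ _).surjective d
  obtain ⟨d', rfl⟩ := (conf _ _).surjective d'
  obtain ⟨c, rfl⟩ := (conf _ _).surjective c
  simp only [Equiv.symm_apply_apply] at hcd
  obtain ⟨c', hc', hm⟩ := exists_honest_of_detect hcd (fires_ofTransitions.1 hd)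
  exact ⟨conf _ _ c', fires_ofTransitions.2 hc', by simpa using hm⟩

/-- While nothing has been detected, Spoiler has been truthful, so his configuration is on a run of
the machine that avoids `h`. This is the second part of the invariant. -/
theorem detectVASS_simulates_honestVASS (hM : ∀ j, (M.step^[j] c₀).1 ≠ h) :
    (M.detectVASS h a b c₀).Simulates (M.honestVASS a b c₀) := by
  refine simulates_of_relation (fun c d => M.Matches ((conf _ _).symm c) ((conf _ _).symm d) ∧
    (((conf _ _).symm d).1.1 = none → ∀ j, (M.step^[j] ((conf _ _).symm c)).1 ≠ h))
    (by simpa [honestVASS, detectVASS, init_ofTransitions] using ⟨M.matches_init c₀, hM⟩) ?_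
  intro c d x c' hcd hc
  obtain ⟨d, rfl⟩ := (conf _ _).surjective d
  obtain ⟨c', rfl⟩ := (conf _ _).surjective c'
  obtain ⟨c, rfl⟩ := (conf _ _).surjective c
  simp only [Equiv.symm_apply_apply] at hcd
  obtain ⟨hm, hj⟩ := hcd
  replace hc := fires_ofTransitions.1 hc
  suffices H : ∃ d', FiresIn (M.detectTrans h a b) d x d' ∧ M.Matches c' d' ∧
      (d'.1.1 = none → ∀ j, (M.step^[j] c').1 ≠ h) by
    obtain ⟨d', hd', H⟩ := H
    exact ⟨conf _ _ d', fires_ofTransitions.2 hd', by simpa using H⟩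
  by_cases hd : d.1.1 = none
  · obtain ⟨⟨m, q⟩, w⟩ := d
    obtain ⟨q', u⟩ := c
    obtain rfl : m = none := hd
    obtain ⟨hq, hu⟩ := hm
    obtain rfl : q = q' := hq
    obtain rfl : u = w := funext fun i => by simpa [debt] using hu i
    have hq : q ≠ h := hj rfl 0
    have hstep : ∀ j, (M.step^[j] (M.step (q, u))).1 ≠ h := fun j => hj rfl (j + 1)
    rcases firesIn_honestTrans.1 hc with ⟨rfl, hs, rfl⟩ | ⟨rfl, rfl⟩
    · refine ⟨((none, M.yes q), (M.fire (q, u)).2),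
        ⟨_, .inl (.inl (.inl (.inl ⟨⟨q, hq⟩, rfl⟩))), rfl, rfl, rfl, fun i =>
          Int.toNat_of_nonneg (hs i)⟩, M.matches_init _, fun _ => ?_⟩
      rwa [step, if_pos hs] at hstep
    -- If the addition succeeds, the letter `a` is a lie and Duplicator detects it; otherwise he
    -- follows the machine.
    · by_cases hs : M.Succeeds (q, u)
      · exact ⟨((some (some q), M.no q), (M.fire (q, u)).2),
          ⟨_, .inl (.inl (.inr ⟨⟨q, hq⟩, rfl⟩)), rfl, rfl, rfl, fun i =>
            Int.toNat_of_nonneg (hs i)⟩,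
          ⟨rfl, fun i => by simp [fire, debt, Int.toNat_of_nonneg (hs i)]⟩, by simp⟩
      · refine ⟨((none, M.no q), u),
          ⟨_, .inl (.inl (.inl (.inr ⟨⟨q, hq⟩, rfl⟩))), rfl, rfl, rfl, fun i => by simp⟩,
          M.matches_init _, fun _ => ?_⟩
        rwa [step, if_neg hs] at hstep
  · obtain ⟨d', hd', hm', hn⟩ := exists_detect_of_honest hm hd hc
    exact ⟨d', hd', hm', fun H => absurd H hn⟩

theorem reads_detect_of_honest {c : Q × (Fin k → ℕ)}
    {d : (Option (Option Q) × Q) × (Fin k → ℕ)} (hcd : M.Matches c d) (hd : d.1.1 ≠ none)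
    {w : List α} (hw : (M.honestVASS a b c₀).Reads (conf _ _ c) w) :
    (M.detectVASS h a b c₀).Reads (conf _ _ d) w := by
  induction w generalizing c d with
  | nil => trivial
  | cons x w ih =>
    obtain ⟨c', hc', hw⟩ := hw
    obtain ⟨c', rfl⟩ := (conf _ _).surjective c'
    obtain ⟨d', hd', hm, hn⟩ := exists_detect_of_honest hcd hd (fires_ofTransitions.1 hc')
    exact ⟨conf _ _ d', fires_ofTransitions.2 hd', ih hm hn hw⟩

theorem reads_honest_of_detect {c : Q × (Fin k → ℕ)}
    {d : (Option (Option Q) × Q) × (Fin k → ℕ)} (hcd : M.Matches c d)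
    {w : List α} (hw : (M.detectVASS h a b c₀).Reads (conf _ _ d) w) :
    (M.honestVASS a b c₀).Reads (conf _ _ c) w := by
  induction w generalizing c d with
  | nil => trivial
  | cons x w ih =>
    obtain ⟨d', hd', hw⟩ := hw
    obtain ⟨d', rfl⟩ := (conf _ _).surjective d'
    obtain ⟨c', hc', hm⟩ := exists_honest_of_detect hcd (fires_ofTransitions.1 hd')
    exact ⟨conf _ _ c', fires_ofTransitions.2 hc', ih hm hw⟩

theorem detectVASS_isHistoryDeterministic (hab : a ≠ b) :
    (M.detectVASS h a b c₀).IsHistoryDeterministic := by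
  refine allAccepting_ofTransitions.isHistoryDeterministic
    (fun d => ∃ c, M.Matches c ((conf _ _).symm d)) ⟨c₀, ?_⟩ ?_
  · simpa [init_ofTransitions] using M.matches_init c₀
  rintro d x ⟨c, hcd⟩ ⟨d₁, hd₁⟩
  obtain ⟨d, rfl⟩ := (conf _ _).surjective d
  obtain ⟨d₁, rfl⟩ := (conf _ _).surjective d₁
  rw [Equiv.symm_apply_apply] at hcd
  replace hd₁ := fires_ofTransitions.1 hd₁
  -- If a successor outside the execution mode exists, it is chosen. All successors match the same
  -- honest configuration, whose words bound theirs and are all read from `e`.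
  by_cases H : ∃ e, FiresIn (M.detectTrans h a b) d x e ∧ e.1.1 ≠ none
  · obtain ⟨e, he, hn⟩ := H
    obtain ⟨c', hc', hm⟩ := exists_honest_of_detect hcd he
    refine ⟨conf _ _ e, fires_ofTransitions.2 he, ⟨c', by simpa using hm⟩, fun e' w he' hw => ?_⟩
    obtain ⟨e', rfl⟩ := (conf _ _).surjective e'
    obtain ⟨c'', hc'', hm'⟩ := exists_honest_of_detect hcd (fires_ofTransitions.1 he')
    obtain rfl := firesIn_honestTrans_unique hab hc' hc''
    exact M.reads_detect_of_honest h c₀ hm hn (M.reads_honest_of_detect h c₀ hm' hw)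
  · push Not at H
    obtain ⟨c', hc', hm⟩ := exists_honest_of_detect hcd hd₁
    refine ⟨conf _ _ d₁, fires_ofTransitions.2 hd₁, ⟨c', by simpa using hm⟩,
      fun e' w he' hw => ?_⟩
    obtain ⟨e', rfl⟩ := (conf _ _).surjective e'
    replace he' := fires_ofTransitions.1 he'
    rwa [firesIn_detectTrans_unique hab hd₁ he' (H _ hd₁) (H _ he')]

open Classical in
/-- The word read by the first `j` steps of a machine, if all claims are true. -/
noncomputable def honestWord (M : TryMachine Q k) (a b : α) : ℕ → Q × (Fin k → ℕ) → List α
  | 0, _ => []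
  | j + 1, c => (if M.Succeeds c then b else a) :: honestWord M a b j (M.step c)

theorem honestVASS_reads (j : ℕ) (c : Q × (Fin k → ℕ)) :
    (M.honestVASS a b c₀).Reads (conf _ _ c) (M.honestWord a b j c ++ [a]) := by
  induction j generalizing c with
  | zero =>
    exact ⟨conf _ _ (M.no c.1, c.2), fires_ofTransitions.2 (firesIn_honestTrans.2 (.inr ⟨rfl, rfl⟩)),
      trivial⟩
  | succ j ih =>
    refine ⟨conf _ _ (M.step c), fires_ofTransitions.2 (firesIn_honestTrans.2 ?_), ih _⟩
    rw [step]
    split_ifs with hs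
    exacts [.inl ⟨rfl, hs, rfl⟩, .inr ⟨rfl, rfl⟩]

/-- On a truthful word a detection would have to fire an addition that fails. So the run is forced
to follow the machine, and is stuck in `h` at the final `a` at the latest. -/
theorem not_detectVASS_reads (hab : a ≠ b) (j : ℕ) (c : Q × (Fin k → ℕ))
    (hj : (M.step^[j] c).1 = h) :
    ¬ (M.detectVASS h a b c₀).Reads (conf _ _ ((none, c.1), c.2)) (M.honestWord a b j c ++ [a]) := by
  have succ_of : ∀ (q : Q) (u w : Fin k → ℕ), (∀ i, (w i : ℤ) = u i + M.eff q i) →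
      M.Succeeds (q, u) := fun q u w hw i => hw i ▸ Int.natCast_nonneg _
  induction j generalizing c with
  | zero =>
    rintro ⟨d, hd, -⟩
    obtain ⟨d, rfl⟩ := (conf _ _).surjective d
    obtain ⟨t, ht, -, hs, -⟩ := fires_ofTransitions.1 hd
    rcases ht with (((⟨q, rfl⟩ | ⟨q, rfl⟩) | ⟨q, rfl⟩) | ⟨p, rfl⟩) | ⟨p, rfl⟩ <;>
      simp only [Prod.mk.injEq, reduceCtorEq, false_and, true_and] at hs <;>
      exact q.2 (hs.symm.trans hj)
  | succ j ih =>
    rintro ⟨d, hd, hw⟩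
    obtain ⟨d, rfl⟩ := (conf _ _).surjective d
    replace hd := fires_ofTransitions.1 hd
    suffices e : d = ((none, (M.step c).1), (M.step c).2) from ih (M.step c) hj (e ▸ hw)
    obtain ⟨q', u⟩ := c
    obtain ⟨t, ht, hl, hs, htgt, he⟩ := hd
    rcases ht with (((⟨q, rfl⟩ | ⟨q, rfl⟩) | ⟨q, rfl⟩) | ⟨p, rfl⟩) | ⟨p, rfl⟩ <;>
      simp only [Prod.mk.injEq, reduceCtorEq, false_and, true_and] at hs htgt hl he <;> subst hs
    · have hsucc := succ_of _ _ _ he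
      rw [step, if_pos hsucc]
      refine Prod.ext htgt (funext fun i => ?_)
      simp [← he i]
    · have hfail : ¬ M.Succeeds (↑q, u) := fun hs => hab (by rwa [if_pos hs] at hl)
      rw [step, if_neg hfail]
      refine Prod.ext htgt (funext fun i => ?_)
      simpa using he i
    · exact absurd (by rwa [if_pos (succ_of _ _ _ he)] at hl) hab

theorem traceLanguage_ne (hab : a ≠ b) {j : ℕ} (hj : (M.step^[j] c₀).1 = h) :
    (M.honestVASS a b c₀).traceLanguage ≠ (M.detectVASS h a b c₀).traceLanguage := by
  intro e
  have hw : M.honestWord a b j c₀ ++ [a] ∈ (M.honestVASS a b c₀).traceLanguage :=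
    mem_traceLanguage_iff.2 (M.honestVASS_reads c₀ j c₀)
  rw [e, mem_traceLanguage_iff] at hw
  exact M.not_detectVASS_reads h c₀ hab j c₀ hj hw

end Finite

end TryMachine

/-! ### Computability of the reduction and the diagonal argument -/

namespace VASS

variable {α : Type*} {k : ℕ}

/-- A description that lists the final configurations and the transitions of a VASS. -/
noncomputable def description (V : VASS α k) : Description α k :=
  (V.numStates, (V.init.1.val, V.init.2), V.final.toList.map fun c => (c.1.val, c.2),
    V.trans.toList.map fun t => (t.src.val, t.letter, t.eff, t.tgt.val))

theorem describedBy_description (V : VASS α k) : V.DescribedBy V.description := by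
  refine ⟨rfl, rfl, fun x => ?_, fun x => ?_⟩ <;> simp [description, eq_comm]

theorem DecidableOn.mono [Primcodable α] {P P' R : VASS α k → VASS α k → Prop}
    (h : DecidableOn P R) (hP : ∀ A B, P' A B → P A B) : DecidableOn P' R := by
  obtain ⟨f, hf, H⟩ := h
  exact ⟨f, hf, fun A B D E hD hE hAB => H A B D E hD hE (hP A B hAB)⟩

theorem _root_.Primrec.two_pow : Primrec fun n : ℕ => 2 ^ n := by
  have h : Primrec fun n : ℕ => n.rec (motive := fun _ => ℕ) 1 fun _ m => 2 * m :=
    Primrec.nat_rec₁ 1 (Primrec.nat_mul.comp (Primrec.const 2) Primrec.snd)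
  refine h.of_eq fun n => ?_
  induction n with
  | zero => rfl
  | succ n ih => exact (congrArg (2 * ·) ih).trans (pow_succ' 2 n).symm

theorem _root_.Primrec.vec_two_pow : Primrec fun n : ℕ => ![2 ^ n, 0] := by
  have h : ∀ i : Fin 2, Primrec fun n : ℕ => ![2 ^ n, 0] i := by
    intro i
    fin_cases i
    · exact Primrec.two_pow
    · exact Primrec.const 0
  exact Primrec.fin_curry.2 (Primrec.fin_curry₁ (f := fun i n => ![2 ^ n, 0] i).2 h).swap

theorem primrec_description [Primcodable α] (m i : ℕ) (F : List (ℕ × (Fin 2 → ℕ)))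
    (L : List (ℕ × α × (Fin 2 → ℤ) × ℕ)) :
    Primrec fun n : ℕ => ((m, (i, ![2 ^ n, 0]), F, L) : Description α 2) :=
  (Primrec.const m).pair (((Primrec.const i).pair Primrec.vec_two_pow).pair (Primrec.const (F, L)))

/-- The descriptions of a fixed VASS that is started with `2 ^ n` in the first counter are
computable from `n`. -/
theorem computable_description_ofTransitions [Primcodable α] {S : Type*} [Finite S]
    {T : Set (VASSTransition S α 2)} (hT : T.Finite) (q : S) :
    Computable fun n : ℕ => (ofTransitions hT (q, ![2 ^ n, 0])).description :=
  -- States, final configurations and transitions do not depend on the initial counters, so those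
  -- for counters `0` enter as constants.
  have h := primrec_description (ofTransitions hT (q, 0)).description.1
    (ofTransitions hT (q, 0)).description.2.1.1 (ofTransitions hT (q, 0)).description.2.2.1
    (ofTransitions hT (q, 0)).description.2.2.2
  Primrec.to_comp (h.of_eq fun _ => rfl)

end VASS

theorem theorem6 {α : Type*} [Finite α] [Nontrivial α] [Primcodable α]
    (R : VASS α 2 → VASS α 2 → Prop) (hR : Equivalence R)
    (hsim : ∀ A B : VASS α 2, A.TwoSidedSimulation B → R A B)
    (hlang : ∀ A B : VASS α 2, A.traceLanguage ≠ B.traceLanguage → ¬ R A B) :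
    ¬ VASS.DecidableOn (fun A B => A.IsDeterministic ∧ B.IsHistoryDeterministic) R ∧
    ¬ VASS.DecidableOn (fun A B => (A.AllAccepting ∧ A.IsDeterministic) ∧
        (B.AllAccepting ∧ B.IsHistoryDeterministic)) R := by
  suffices H : ¬ VASS.DecidableOn (fun A B => (A.AllAccepting ∧ A.IsDeterministic) ∧
      (B.AllAccepting ∧ B.IsHistoryDeterministic)) R from
    ⟨fun h => H (h.mono fun A B h => ⟨h.1.2, h.2.2⟩), H⟩
  rintro ⟨g, hg, hgR⟩
  obtain ⟨a, b, hab⟩ := exists_pair_ne α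
  have diag : Partrec fun n : ℕ => (Denumerable.ofNat Nat.Partrec.Code n).eval n :=
    Nat.Partrec.Code.eval_part.comp (Computable.ofNat _) Computable.id
  obtain ⟨Q, _, M, q₀, h, hM⟩ := TryMachine.exists_of_partrec diag
  let A : ℕ → VASS α 2 := fun n => M.honestVASS a b (q₀, ![2 ^ n, 0])
  let B : ℕ → VASS α 2 := fun n => M.detectVASS h a b (q₀, ![2 ^ n, 0])
  have answer : Partrec fun n => (g ((A n).description, (B n).description)).map fun r => cond r 1 0 :=
    (hg.comp ((VASS.computable_description_ofTransitions (M.finite_honestTrans a b) q₀).pair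
      (VASS.computable_description_ofTransitions (M.finite_detectTrans h a b) (none, q₀)))).map
      (Computable.cond Computable.snd (Computable.const 1) (Computable.const 0)).to₂
  -- At the index `n` of the answering function itself, the machine evaluates the answer about `A n`
  -- and `B n`: it halts if the answer is yes, and does not if it is no.
  obtain ⟨c, hc⟩ := Nat.Partrec.Code.exists_code.1 (Partrec.nat_iff.1 answer)
  obtain ⟨n, rfl⟩ : ∃ n, Denumerable.ofNat Nat.Partrec.Code n = c :=
    ⟨Encodable.encode c, Denumerable.ofNat_encode c⟩
  obtain ⟨r, hr, hrR⟩ := hgR (A n) (B n) _ _ (A n).describedBy_description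
    (B n).describedBy_description
    ⟨⟨VASS.allAccepting_ofTransitions, M.honestVASS_isDeterministic _ hab⟩,
      ⟨VASS.allAccepting_ofTransitions, M.detectVASS_isHistoryDeterministic h _ hab⟩⟩
  have hy : cond r 1 0 ∈ (Denumerable.ofNat Nat.Partrec.Code n).eval n := by
    rw [hc]
    exact Part.mem_map _ hr
  have halts := hM n _ hy
  by_cases H : ∃ j, (M.step^[j] (q₀, ![2 ^ n, 0])).1 = h
  · have hr1 : r = true := by
      have := halts.1 H
      cases r <;> simp_all
    obtain ⟨j, hj⟩ := H
    exact hlang _ _ (M.traceLanguage_ne h _ hab hj) (hrR.1 hr1)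
  · have hr0 : r ≠ true := fun hr1 => H (halts.2 (by simp [hr1]))
    exact hr0 (hrR.2 (hsim _ _ ⟨M.honestVASS_simulates_detectVASS h _,
      M.detectVASS_simulates_honestVASS h _ (not_exists.1 H)⟩))
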